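/- Let $p\in(0,1)\setminus\{1/2\}$, $q\in[0,1]$, $f:[0,1]\to[0,1]$, and let $k(n)$, $n\ge 1$, be a non-decreasing sequence of positive integers with $k(n)\le n$ and $k(n)\to\infty$. Consider the generalized elephant random walk with sampling with replacement: $X_0=0$; $X_1$ equals $+1$ with probability $q$ and $-1$ with probability $1-q$; for each $n\ge1$, draw $U_{n,1},\dots,U_{n,k(n)}$ i.i.d. uniformly from $\{1,\dots,n\}$, independently of the past $\mathcal F_n$ (the $\sigma$-field generated by $X_1,\dots,X_n$ and the samples drawn at times before $n$), put $C_n^+=\#\{i\le k(n): X_{U_{n,i}}=1\}$, and, conditionally on $\mathcal F_n$ and $U_{n,1},\dots,U_{n,k(n)}$, let $X_{n+1}=+1$ with probability $g(C_n^+/k(n))$ and $X_{n+1}=-1$ with probability $1-g(C_n^+/k(n))$, where $$g(x)=p f(x)+(1-p)\{1-f(x)\},\qquad x\in[0,1].$$ Let $S_n=\sum_{i=1}^n X_i$. Assume that one of the following holds: (F1) $f$ is continuous on $[0,1]$ and $\sum_{n\ge1}\frac1{n+1}\sup\{|f(x)-f(y)|:x,y\in[0,1],\,|x-y|<k(n)^{-1/2}\}$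 converges; (F2) there are $0<\alpha\le1$ and $L$ with $|f(x)-f(y)|\le L|x-y|^\alpha$ for all $x,y\in[0,1]$, and $\sum_{n\ge1}(n+1)^{-1}k(n)^{-\alpha/2}$ converges; (F3) $f\in\mathcal C^1[0,1]$ and $\sum_{n\ge1}\frac1{(n+1)\sqrt{k(n)}}\sup\{|f'(x)-f'(y)|:x,y\in[0,1],\,|x-y|<k(n)^{-1/2}\}$ converges; (F4) $f\in\mathcal C^2[0,1]$ and $\sum_{n\ge1}(n+1)^{-1}k(n)^{-1}$ converges. Then: 1. If $g$ has a unique fixed point $x^*$ in $[0,1]$ and $\{g(x)-x\}(x-x^*)<0$ for every $x\in[0,1]\setminus\{x^*\}$, then $S_n/n\to 2x^*-1$ almost surely. 2. In particular, the conclusion $S_n/n\to2x^*-1$ almost surely holds as soon as $g$ has a unique fixed point $x^*$ in $[0,1]$. 3. The function $g$ has a unique fixed point $x^*$ in $[0,1]$, and $S_n/n\to2x^*-1$ almost surely, if one of the following is true: (G1) $f\in\mathcal C^1[0,1]$, and either $p>1/2$ and $f$ is strictly decreasing on $[0,1]$, or $p<1/2$ and $f$ is strictly increasing on $[0,1]$;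 (G2) $f\in\mathcal C^2[0,1]$, and $f$ is either strictly convex on $(0,1)$ or strictly concave on $(0,1)$; (G3) there is $c$ with $|f(x)-f(y)|\le c|x-y|$ for all $x,y\in[0,1]$ and $c|2p-1|<1$. -/

import Mathlib

open MeasureTheory ProbabilityTheory Filter Topology

noncomputable section

namespace ElephantWalk

/-- The position `S_n = X_1 + ⋯ + X_n` of the walker at time `n`. -/
def position {Ω : Type*} (X : ℕ → Ω → ℝ) (n : ℕ) (ω : Ω) : ℝ :=
  ∑ i ∈ Finset.Icc 1 n, X i ω

/-- `C_n⁺`: the number of sampled time-stamps `U_{n,i}`, `1 ≤ i ≤ k(n)`, at which the step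
was `+1`. -/
def plusCount {Ω : Type*} {k : ℕ → ℕ} (X : ℕ → Ω → ℝ) (U : (n : ℕ) → Fin (k n) → Ω → ℕ)
    (n : ℕ) (ω : Ω) : ℝ :=
  ∑ i : Fin (k n), Set.indicator {ω' | X (U n i ω') ω' = 1} (fun _ => (1 : ℝ)) ω

/-- The `σ`-field generated by the sample `U_{n,1}, …, U_{n,k(n)}` drawn at time `n`. -/
abbrev sampleField {Ω : Type*} {k : ℕ → ℕ} (U : (n : ℕ) → Fin (k n) → Ω → ℕ) (n : ℕ) :
    MeasurableSpace Ω :=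
  ⨆ i : Fin (k n), MeasurableSpace.comap (U n i) ⊤

/-- `ℱ_n`: all information up to and including time `n`, i.e. the `σ`-field generated by the
steps `X_1, …, X_n` and by the samples that were used to produce them (those drawn at the times
`1 ≤ m < n`). -/
abbrev history {Ω : Type*} {k : ℕ → ℕ} (X : ℕ → Ω → ℝ) (U : (n : ℕ) → Fin (k n) → Ω → ℕ)
    (n : ℕ) : MeasurableSpace Ω :=
  (⨆ m ∈ Finset.Icc 1 n, MeasurableSpace.comap (X m) (borel ℝ)) ⊔
    ⨆ m ∈ Finset.Ico 1 n, sampleField U m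

/-- `(X, U)` is, on the probability space `(Ω, μ)`, a generalized elephant random walk with
sampling with replacement: memory parameter `p`, first-step parameter `q`, reinforcement function
`f` (only its values on `[0,1]` matter) and sample sizes `k(n)`. -/
structure IsWalkWithReplacement {Ω : Type*} [MeasurableSpace Ω] (μ : Measure Ω)
    (p q : ℝ) (f : ℝ → ℝ) (k : ℕ → ℕ) (X : ℕ → Ω → ℝ)
    (U : (n : ℕ) → Fin (k n) → Ω → ℕ) : Prop where
  measurable_step : ∀ n, Measurable (X n)
  measurable_sample : ∀ n i, Measurable (U n i)
  step_zero : ∀ ω, X 0 ω = 0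
  /-- `X_1` is Rademacher(`q`). -/
  first_plus : μ.real {ω | X 1 ω = 1} = q
  first_minus : μ.real {ω | X 1 ω = -1} = 1 - q
  /-- Each `U_{n,i}` is uniform on `{1, …, n}`. -/
  sample_uniform : ∀ n, 1 ≤ n → ∀ i : Fin (k n), ∀ j ∈ Finset.Icc 1 n,
    μ.real {ω | U n i ω = j} = 1 / (n : ℝ)
  /-- The draws `U_{n,1}, …, U_{n,k(n)}` are mutually independent … -/
  sample_iIndep : ∀ n, 1 ≤ n → iIndepFun (U n) μ
  /-- … and the sample is drawn independently of the past. -/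
  sample_indep_history : ∀ n, 1 ≤ n → Indep (sampleField U n) (history X U n) μ
  /-- Conditional law of `X_{n+1}` given `ℱ_n` and `U_{n,1}, …, U_{n,k(n)}`. -/
  step_plus : ∀ n, 1 ≤ n →
    μ[Set.indicator {ω | X (n + 1) ω = 1} (fun _ => (1 : ℝ)) | history X U n ⊔ sampleField U n]
      =ᵐ[μ] fun ω => p * f (plusCount X U n ω / k n) + (1 - p) * (1 - f (plusCount X U n ω / k n))
  step_minus : ∀ n, 1 ≤ n →
    μ[Set.indicator {ω | X (n + 1) ω = -1} (fun _ => (1 : ℝ)) | history X U n ⊔ sampleField U n]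
      =ᵐ[μ] fun ω => (1 - p) * f (plusCount X U n ω / k n) + p * (1 - f (plusCount X U n ω / k n))

/-- `g(x) = p f(x) + (1 - p) (1 - f(x))`. -/
def drift (p : ℝ) (f : ℝ → ℝ) (x : ℝ) : ℝ := p * f x + (1 - p) * (1 - f x)

/-- `x` is a fixed point of `g` in `[0,1]`, and the only one. -/
def IsUniqueFixedPoint (g : ℝ → ℝ) (x : ℝ) : Prop :=
  x ∈ Set.Icc (0 : ℝ) 1 ∧ g x = x ∧ ∀ y ∈ Set.Icc (0 : ℝ) 1, g y = y → y = x

/-- `sup {|φ(x) - φ(y)| : x, y ∈ [0,1], |x - y| < δ}`. -/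
def modulus (φ : ℝ → ℝ) (δ : ℝ) : ℝ :=
  sSup {r | ∃ x ∈ Set.Icc (0 : ℝ) 1, ∃ y ∈ Set.Icc (0 : ℝ) 1, |x - y| < δ ∧ r = |φ x - φ y|}

/-- The series `∑_{n = 1}^∞ a n` converges. -/
def SeriesConverges (a : ℕ → ℝ) : Prop :=
  ∃ l : ℝ, Tendsto (fun N : ℕ => ∑ n ∈ Finset.Icc 1 N, a n) atTop (𝓝 l)

/-- One of the four alternative conditions on the regularity of `f` on `[0,1]` and on the growth
of the sample sizes `k(n)`. The derivative in the third one is the derivative on `[0,1]`,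
one-sided at the end points. -/
def RegularityCondition (f : ℝ → ℝ) (k : ℕ → ℕ) : Prop :=
  (ContinuousOn f (Set.Icc 0 1) ∧
    SeriesConverges fun n => 1 / ((n : ℝ) + 1) * modulus f ((k n : ℝ) ^ (-(1 / 2) : ℝ))) ∨
  (∃ α L : ℝ, 0 < α ∧ α ≤ 1 ∧
    (∀ x ∈ Set.Icc (0 : ℝ) 1, ∀ y ∈ Set.Icc (0 : ℝ) 1, |f x - f y| ≤ L * |x - y| ^ α) ∧
    SeriesConverges fun n => 1 / ((n : ℝ) + 1) * (k n : ℝ) ^ (-(α / 2))) ∨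
  (ContDiffOn ℝ 1 f (Set.Icc 0 1) ∧
    SeriesConverges fun n => 1 / (((n : ℝ) + 1) * Real.sqrt (k n)) *
      modulus (derivWithin f (Set.Icc 0 1)) ((k n : ℝ) ^ (-(1 / 2) : ℝ))) ∨
  (ContDiffOn ℝ 2 f (Set.Icc 0 1) ∧
    SeriesConverges fun n => 1 / (((n : ℝ) + 1) * (k n : ℝ)))

end ElephantWalk

end

open MeasureTheory ProbabilityTheory Filter Topology

noncomputable section

namespace ElephantWalk

/-! ### Deterministic recursions with a restoring drift -/

/-! Let `T n` be the proportion of `+1` among the first `n` steps; almost surely `S_n / n = 2 T n -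
1`. It obeys a stochastic approximation recursion with step size `1/(n+1)`, whose increment splits
into the drift `g (T n) - T n`, a bias `E[1{X_{n+1} = 1} | ℱ_n] - g (T n)`, and a martingale
difference.

The weighted martingale differences have square-summable bounds, so their sum converges
(`ae_exists_tendsto_sum_of_condExp_eq_zero`). Given `ℱ_n`, the sampled fraction has mean square
distance at most `1 / k n` from `T n` (`condExp_sq_plusCount_div_sub_le`); uniform continuity of `g`
and `k n → ∞` then send the bias to zero. Adding the tail of the martingale series to `T n` leaves a
noise-free recursion, pathwise covered by `tendsto_of_drift`: the step sizes tend to zero but have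
infinite sum, so a drift pointing to `x` forces convergence to `x`.

The drift does point to a unique fixed point: `g` maps `[0,1]` into itself, so a wrong sign would
create another fixed point by the intermediate value theorem. Under (G1), (G2), (G3) existence is
again the intermediate value theorem, and uniqueness comes from monotonicity, strict convexity of
`±(g x - x)`, or contraction. -/

/-- Divergence of `∑ a n` prevents `V` from staying above `c`. Once below, it can cross `c` only by
a single step, eventually shorter than `ε`, and above `c` it does not increase. -/
theorem eventually_lt_of_decrease {V a : ℕ → ℝ} {c δ C ε : ℝ} (hδ : 0 < δ) (hε : 0 < ε)
    (ha : ∀ n, 0 ≤ a n) (ha0 : Tendsto a atTop (𝓝 0))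
    (hsum : Tendsto (fun n => ∑ i ∈ Finset.range n, a i) atTop atTop)
    (hdec : ∀ᶠ n in atTop, c ≤ V n → V (n + 1) ≤ V n - δ * a n)
    (hinc : ∀ᶠ n in atTop, V (n + 1) ≤ V n + C * a n) :
    ∀ᶠ n in atTop, V n < c + ε := by
  have hsmall : ∀ᶠ n in atTop, C * a n < ε := by
    have h : Tendsto (fun n => C * a n) atTop (𝓝 0) := by simpa using ha0.const_mul C
    exact h.eventually_lt_const hε
  obtain ⟨N, hN⟩ := eventually_atTop.1 (hdec.and (hinc.and hsmall))
  have hex : ∃ n ≥ N, V n < c := by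
    by_contra! hcon
    have hle : ∀ m, V (N + m) ≤
        V N - δ * (∑ i ∈ Finset.range (N + m), a i - ∑ i ∈ Finset.range N, a i) := by
      intro m
      induction m with
      | zero => simp
      | succ m ih =>
        have h1 := (hN (N + m) (by omega)).1 (hcon _ (by omega))
        rw [← add_assoc, Finset.sum_range_succ]
        nlinarith
    -- `(V N - c) / δ` is the total step size that brings `V` from `V N` down to `c`.
    obtain ⟨m, hmN, hm⟩ := ((eventually_ge_atTop N).and (hsum.eventually_gt_atTop
      ((V N - c) / δ + ∑ i ∈ Finset.range N, a i))).exists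
    obtain ⟨j, rfl⟩ := Nat.exists_eq_add_of_le hmN
    have h1 := hle j
    have h2 := hcon (N + j) (by omega)
    have h3 : (V N - c) / δ < ∑ i ∈ Finset.range (N + j), a i - ∑ i ∈ Finset.range N, a i := by
      linarith
    rw [div_lt_iff₀ hδ] at h3
    nlinarith
  obtain ⟨n₀, hn₀, hV⟩ := hex
  refine eventually_atTop.2 ⟨n₀, fun n hn => ?_⟩
  induction n, hn using Nat.le_induction with
  | base => linarith
  | succ n hn ih =>
    obtain ⟨h1, h2, h3⟩ := hN n (by omega)
    rcases lt_or_ge (V n) c with hlt | hge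
    · linarith
    · have := h1 hge
      have := mul_nonneg hδ.le (ha n)
      linarith

/-- The drift is evaluated at `T`, not at `V`, but `x + ε/2 ≤ V n` eventually forces `x + ε/4 ≤ T
n`. There compactness gives `h ≤ -δ`, and half of `δ` absorbs the error `e`. -/
theorem eventually_lt_of_drift {T V a e : ℕ → ℝ} {h : ℝ → ℝ} {K : Set ℝ} {x : ℝ}
    (hK : IsCompact K) (hh : ContinuousOn h K) (hneg : ∀ y ∈ K, x < y → h y < 0)
    (hT : ∀ n, T n ∈ K) (hTV : Tendsto (fun n => V n - T n) atTop (𝓝 0))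
    (ha : ∀ n, 0 ≤ a n) (ha0 : Tendsto a atTop (𝓝 0))
    (hsum : Tendsto (fun n => ∑ i ∈ Finset.range n, a i) atTop atTop)
    (he : Tendsto e atTop (𝓝 0))
    (hV : ∀ᶠ n in atTop, V (n + 1) = V n + a n * (h (T n) + e n)) {ε : ℝ} (hε : 0 < ε) :
    ∀ᶠ n in atTop, V n < x + ε := by
  obtain ⟨δ, hδ, hδK⟩ := (hK.inter_right (isClosed_Ici (a := x + ε / 4))).exists_forall_le'
    (f := fun y => -h y) (a := 0) (hh.mono Set.inter_subset_left).neg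
    (fun y hy => by have := hneg y hy.1 (by have := hy.2; simp at this; linarith); linarith)
  obtain ⟨B, hB⟩ := hK.exists_bound_of_continuousOn hh
  have he1 : ∀ᶠ n in atTop, e n < δ / 2 := he.eventually_lt_const (by positivity)
  have he2 : ∀ᶠ n in atTop, e n < 1 := he.eventually_lt_const one_pos
  have hVT : ∀ᶠ n in atTop, V n - T n < ε / 4 := hTV.eventually_lt_const (by positivity)
  have key := eventually_lt_of_decrease (V := V) (a := a) (c := x + ε / 2) (δ := δ / 2)
    (C := B + 1) (ε := ε / 2) (by positivity) (by positivity) ha ha0 hsum ?_ ?_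
  · filter_upwards [key] with n hn
    linarith
  · filter_upwards [he1, hVT, hV] with n h1 h2 h3 h4
    have h5 := hδK (T n) ⟨hT n, by simp; linarith⟩
    have := mul_le_mul_of_nonneg_left (show h (T n) + e n ≤ -(δ / 2) by linarith) (ha n)
    rw [h3]
    linarith
  · filter_upwards [he2, hV] with n h1 h3
    have h5 := (le_abs_self _).trans (hB (T n) (hT n))
    have := mul_le_mul_of_nonneg_left (show h (T n) + e n ≤ B + 1 by linarith) (ha n)
    rw [h3]
    linarith

theorem tendsto_of_drift {T V a e : ℕ → ℝ} {h : ℝ → ℝ} {K : Set ℝ} {x : ℝ}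
    (hK : IsCompact K) (hh : ContinuousOn h K) (hneg : ∀ y ∈ K, x < y → h y < 0)
    (hpos : ∀ y ∈ K, y < x → 0 < h y)
    (hT : ∀ n, T n ∈ K) (hTV : Tendsto (fun n => V n - T n) atTop (𝓝 0))
    (ha : ∀ n, 0 ≤ a n) (ha0 : Tendsto a atTop (𝓝 0))
    (hsum : Tendsto (fun n => ∑ i ∈ Finset.range n, a i) atTop atTop)
    (he : Tendsto e atTop (𝓝 0))
    (hV : ∀ᶠ n in atTop, V (n + 1) = V n + a n * (h (T n) + e n)) :
    Tendsto V atTop (𝓝 x) := by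
  refine tendsto_order.2 ⟨fun b hb => ?_, fun b hb => ?_⟩
  -- The lower bound is the upper bound for the system reflected through the origin.
  · have key := eventually_lt_of_drift (T := fun n => -T n) (V := fun n => -V n) (a := a)
      (e := fun n => -e n) (h := fun y => -h (-y)) (K := -K) (x := -x) (ε := x - b) hK.neg
      ((hh.comp continuous_neg.continuousOn (fun y hy => hy)).neg)
      (fun y hy hxy => by have := hpos (-y) hy (by linarith); linarith)
      (fun n => by simpa using hT n)
      (by simpa [sub_eq_add_neg, add_comm] using hTV.neg) ha ha0 hsum (by simpa using he.neg)
      (by filter_upwards [hV] with n hn; rw [hn, neg_neg]; ring) (by linarith)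
    filter_upwards [key] with n hn
    linarith
  · filter_upwards [eventually_lt_of_drift hK hh hneg hT hTV ha ha0 hsum he hV
      (sub_pos.2 hb)] with n hn
    linarith

/-! ### Fixed points of the drift -/

section Drift

variable {p : ℝ} {f : ℝ → ℝ}

theorem drift_eq (p : ℝ) (f : ℝ → ℝ) (x : ℝ) : drift p f x = (2 * p - 1) * f x + (1 - p) := by
  unfold drift; ring

/-- `g x` is a convex combination of `p` and `1 - p`. The strict bounds keep fixed points away from
`0` and `1`. -/
theorem drift_mem_Ioo (hp : p ∈ Set.Ioo (0 : ℝ) 1)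
    (hf : ∀ x ∈ Set.Icc (0 : ℝ) 1, f x ∈ Set.Icc (0 : ℝ) 1) {x : ℝ}
    (hx : x ∈ Set.Icc (0 : ℝ) 1) : drift p f x ∈ Set.Ioo (0 : ℝ) 1 := by
  obtain ⟨h1, h2⟩ := hf x hx
  obtain ⟨h3, h4⟩ := hp
  constructor <;> unfold drift <;> rcases eq_or_lt_of_le h1 with h | h <;>
    first
    | (rw [← h]; linarith)
    | nlinarith [mul_pos h3 h, mul_nonneg (sub_nonneg.2 h4.le) (sub_nonneg.2 h2),
        mul_nonneg h3.le (sub_nonneg.2 h2), mul_pos (sub_pos.2 h4) h]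

theorem drift_mem_Icc (hp : p ∈ Set.Ioo (0 : ℝ) 1)
    (hf : ∀ x ∈ Set.Icc (0 : ℝ) 1, f x ∈ Set.Icc (0 : ℝ) 1) {x : ℝ}
    (hx : x ∈ Set.Icc (0 : ℝ) 1) : drift p f x ∈ Set.Icc (0 : ℝ) 1 :=
  Set.Ioo_subset_Icc_self (drift_mem_Ioo hp hf hx)

theorem continuousOn_drift {s : Set ℝ} (hc : ContinuousOn f s) :
    ContinuousOn (drift p f) s :=
  (hc.const_smul (2 * p - 1) |>.add (continuousOn_const (c := 1 - p))).congr
    fun x _ => by simp [drift_eq]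

theorem exists_drift_eq_self (hp : p ∈ Set.Ioo (0 : ℝ) 1)
    (hf : ∀ x ∈ Set.Icc (0 : ℝ) 1, f x ∈ Set.Icc (0 : ℝ) 1)
    (hc : ContinuousOn f (Set.Icc 0 1)) : ∃ x ∈ Set.Icc (0 : ℝ) 1, drift p f x = x := by
  have h0 := (drift_mem_Icc hp hf (Set.left_mem_Icc.2 zero_le_one)).1
  have h1 := (drift_mem_Icc hp hf (Set.right_mem_Icc.2 zero_le_one)).2
  obtain ⟨x, hx, hx0⟩ := intermediate_value_Icc' zero_le_one
    ((continuousOn_drift (p := p) hc).sub continuousOn_id)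
    (show (0 : ℝ) ∈ Set.Icc _ _ from ⟨by simpa using h1, by simpa using h0⟩)
  exact ⟨x, hx, sub_eq_zero.1 hx0⟩

/-- Since `0 ≤ g 0`, having `g y ≤ y` would produce a fixed point in `[0, y]`, to the left of `x`.
-/
theorem IsUniqueFixedPoint.lt_drift (hp : p ∈ Set.Ioo (0 : ℝ) 1)
    (hf : ∀ x ∈ Set.Icc (0 : ℝ) 1, f x ∈ Set.Icc (0 : ℝ) 1)
    (hc : ContinuousOn f (Set.Icc 0 1)) {x y : ℝ} (hx : IsUniqueFixedPoint (drift p f) x)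
    (hy : y ∈ Set.Icc (0 : ℝ) 1) (hyx : y < x) : y < drift p f y := by
  by_contra! hcon
  obtain ⟨z, hz, hz0⟩ := intermediate_value_Icc' hy.1
    (((continuousOn_drift (p := p) hc).sub continuousOn_id).mono
      (Set.Icc_subset_Icc_right hy.2))
    (show (0 : ℝ) ∈ Set.Icc _ _ from ⟨by simpa using hcon, by
      simpa using (drift_mem_Icc hp hf (Set.left_mem_Icc.2 zero_le_one)).1⟩)
  have := hx.2.2 z ⟨hz.1, hz.2.trans hy.2⟩ (sub_eq_zero.1 hz0)
  have := hz.2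
  linarith

theorem IsUniqueFixedPoint.drift_lt (hp : p ∈ Set.Ioo (0 : ℝ) 1)
    (hf : ∀ x ∈ Set.Icc (0 : ℝ) 1, f x ∈ Set.Icc (0 : ℝ) 1)
    (hc : ContinuousOn f (Set.Icc 0 1)) {x y : ℝ} (hx : IsUniqueFixedPoint (drift p f) x)
    (hy : y ∈ Set.Icc (0 : ℝ) 1) (hxy : x < y) : drift p f y < y := by
  by_contra! hcon
  obtain ⟨z, hz, hz0⟩ := intermediate_value_Icc' hy.2
    (((continuousOn_drift (p := p) hc).sub continuousOn_id).mono
      (Set.Icc_subset_Icc_left hy.1))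
    (show (0 : ℝ) ∈ Set.Icc _ _ from ⟨by
      simpa using (drift_mem_Icc hp hf (Set.right_mem_Icc.2 zero_le_one)).2, by
      simpa using hcon⟩)
  have := hx.2.2 z ⟨hy.1.trans hz.1, hz.2⟩ (sub_eq_zero.1 hz0)
  have := hz.1
  linarith

theorem exists_isUniqueFixedPoint (hp : p ∈ Set.Ioo (0 : ℝ) 1)
    (hf : ∀ x ∈ Set.Icc (0 : ℝ) 1, f x ∈ Set.Icc (0 : ℝ) 1)
    (hc : ContinuousOn f (Set.Icc 0 1))
    (huniq : ∀ x ∈ Set.Icc (0 : ℝ) 1, ∀ y ∈ Set.Icc (0 : ℝ) 1, x < y →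
      drift p f x = x → drift p f y ≠ y) :
    ∃ x, IsUniqueFixedPoint (drift p f) x := by
  obtain ⟨x, hx, hfx⟩ := exists_drift_eq_self hp hf hc
  refine ⟨x, hx, hfx, fun y hy hfy => ?_⟩
  rcases lt_trichotomy x y with h | h | h
  · exact absurd hfy (huniq x hx y hy h hfx)
  · exact h.symm
  · exact absurd hfx (huniq y hy x hx h hfy)

/-- A strictly convex function that is negative at `1` vanishes at most once in `(0, 1)`. -/
theorem ne_zero_of_strictConvexOn {h : ℝ → ℝ} (hh : ContinuousOn h (Set.Icc 0 1))
    (hconv : StrictConvexOn ℝ (Set.Ioo 0 1) h) (h1 : h 1 < 0) {x y : ℝ}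
    (hx : 0 < x) (hxy : x < y) (hy : y < 1) (hx0 : h x = 0) : h y ≠ 0 := by
  intro hy0
  -- Convexity is only available on the open interval, so `1` is replaced by a nearby `z > y` with
  -- `h z < 0`. As `y` lies between `x` and `z`, strict convexity gives `h y < max (h x) (h z) = 0`.
  have hev : ∀ᶠ z in 𝓝[<] (1 : ℝ), h z < 0 := by
    have := (hh 1 (Set.right_mem_Icc.2 zero_le_one)).eventually_lt_const h1
    refine this.filter_mono ?_
    rw [← nhdsWithin_Ioo_eq_nhdsLT (show (0 : ℝ) < 1 by norm_num)]
    exact nhdsWithin_mono _ Set.Ioo_subset_Icc_self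
  obtain ⟨z, hz, hzy, hz1⟩ := (hev.and (Ioo_mem_nhdsLT hy)).exists
  have := hconv.lt_on_openSegment ⟨hx, hxy.trans hy⟩ ⟨hx.trans (hxy.trans hzy), hz1⟩
    (hxy.trans hzy).ne (by rw [openSegment_eq_Ioo (hxy.trans hzy)]; exact ⟨hxy, hzy⟩)
  rw [hx0, hy0, max_eq_left hz.le] at this
  exact lt_irrefl _ this

/-- A strictly concave function that is positive at `0` vanishes at most once in `(0, 1)`. -/
theorem ne_zero_of_strictConcaveOn {h : ℝ → ℝ} (hh : ContinuousOn h (Set.Icc 0 1))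
    (hconc : StrictConcaveOn ℝ (Set.Ioo 0 1) h) (h0 : 0 < h 0) {x y : ℝ}
    (hx : 0 < x) (hxy : x < y) (hy : y < 1) (hx0 : h x = 0) : h y ≠ 0 := by
  intro hy0
  have hev : ∀ᶠ z in 𝓝[>] (0 : ℝ), 0 < h z := by
    have := (hh 0 (Set.left_mem_Icc.2 zero_le_one)).eventually_const_lt h0
    refine this.filter_mono ?_
    rw [← nhdsWithin_Ioo_eq_nhdsGT (show (0 : ℝ) < 1 by norm_num)]
    exact nhdsWithin_mono _ Set.Ioo_subset_Icc_self
  obtain ⟨z, hz, hz0, hzx⟩ := (hev.and (Ioo_mem_nhdsGT hx)).exists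
  have := hconc.lt_on_openSegment ⟨hz0, hzx.trans (hxy.trans hy)⟩ ⟨hx.trans hxy, hy⟩
    (hzx.trans hxy).ne (by rw [openSegment_eq_Ioo (hzx.trans hxy)]; exact ⟨hzx, hxy⟩)
  rw [hx0, hy0, min_eq_right hz.le] at this
  exact lt_irrefl _ this

/-- `g x - x` is `(2 * p - 1) * f x` plus an affine function, so the sign of `2 * p - 1` decides
whether convexity is kept or reversed. -/
theorem strictConvexOn_drift_sub {s : Set ℝ}
    (h : 1 / 2 < p ∧ StrictConvexOn ℝ s f ∨ p < 1 / 2 ∧ StrictConcaveOn ℝ s f) :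
    StrictConvexOn ℝ s fun x => drift p f x - x := by
  rcases h with ⟨hp, hf⟩ | ⟨hp, hf⟩ <;> refine ⟨hf.1, fun x hx y hy hxy a b ha hb hab => ?_⟩
  · have := mul_lt_mul_of_pos_left (hf.2 hx hy hxy ha hb hab) (show 0 < 2 * p - 1 by linarith)
    simp only [drift_eq, smul_eq_mul] at *
    linear_combination this + (p - 1) * hab
  · have := mul_lt_mul_of_pos_left (hf.2 hx hy hxy ha hb hab) (show 0 < 1 - 2 * p by linarith)
    simp only [drift_eq, smul_eq_mul] at *
    linear_combination this + (p - 1) * hab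

theorem strictConcaveOn_drift_sub {s : Set ℝ}
    (h : 1 / 2 < p ∧ StrictConcaveOn ℝ s f ∨ p < 1 / 2 ∧ StrictConvexOn ℝ s f) :
    StrictConcaveOn ℝ s fun x => drift p f x - x := by
  rcases h with ⟨hp, hf⟩ | ⟨hp, hf⟩ <;> refine ⟨hf.1, fun x hx y hy hxy a b ha hb hab => ?_⟩
  · have := mul_lt_mul_of_pos_left (hf.2 hx hy hxy ha hb hab) (show 0 < 2 * p - 1 by linarith)
    simp only [drift_eq, smul_eq_mul] at *
    linear_combination this - (p - 1) * hab
  · have := mul_lt_mul_of_pos_left (hf.2 hx hy hxy ha hb hab) (show 0 < 1 - 2 * p by linarith)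
    simp only [drift_eq, smul_eq_mul] at *
    linear_combination this - (p - 1) * hab

theorem exists_isUniqueFixedPoint_of_strictAntiOn (hp : p ∈ Set.Ioo (0 : ℝ) 1)
    (hf : ∀ x ∈ Set.Icc (0 : ℝ) 1, f x ∈ Set.Icc (0 : ℝ) 1)
    (hc : ContinuousOn f (Set.Icc 0 1))
    (h : 1 / 2 < p ∧ StrictAntiOn f (Set.Icc 0 1) ∨ p < 1 / 2 ∧ StrictMonoOn f (Set.Icc 0 1)) :
    ∃ x, IsUniqueFixedPoint (drift p f) x := by
  refine exists_isUniqueFixedPoint hp hf hc fun x hx y hy hxy hfx hfy => ?_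
  rw [drift_eq] at hfx hfy
  rcases h with ⟨hp, hf⟩ | ⟨hp, hf⟩ <;> have := hf hx hy hxy <;> nlinarith

theorem exists_isUniqueFixedPoint_of_strictConvexOn (hp : p ∈ Set.Ioo (0 : ℝ) 1)
    (hp' : p ≠ 1 / 2) (hf : ∀ x ∈ Set.Icc (0 : ℝ) 1, f x ∈ Set.Icc (0 : ℝ) 1)
    (hc : ContinuousOn f (Set.Icc 0 1))
    (h : StrictConvexOn ℝ (Set.Ioo 0 1) f ∨ StrictConcaveOn ℝ (Set.Ioo 0 1) f) :
    ∃ x, IsUniqueFixedPoint (drift p f) x := by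
  refine exists_isUniqueFixedPoint hp hf hc fun x hx y hy hxy hfx hfy => ?_
  have hx0 : 0 < x := hfx ▸ (drift_mem_Ioo hp hf hx).1
  have hy1 : y < 1 := hfy ▸ (drift_mem_Ioo hp hf hy).2
  have hcont : ContinuousOn (fun x => drift p f x - x) (Set.Icc 0 1) :=
    (continuousOn_drift hc).sub continuousOn_id
  have h0 : 0 < drift p f 0 - 0 := by
    simpa using (drift_mem_Ioo hp hf (Set.left_mem_Icc.2 zero_le_one)).1
  have h1 : drift p f 1 - 1 < 0 := by
    simpa using (drift_mem_Ioo hp hf (Set.right_mem_Icc.2 zero_le_one)).2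
  have hcase : StrictConvexOn ℝ (Set.Ioo 0 1) (fun x => drift p f x - x) ∨
      StrictConcaveOn ℝ (Set.Ioo 0 1) (fun x => drift p f x - x) := by
    rcases lt_or_gt_of_ne hp' with hlt | hgt <;> rcases h with h | h
    · exact .inr (strictConcaveOn_drift_sub (.inr ⟨hlt, h⟩))
    · exact .inl (strictConvexOn_drift_sub (.inr ⟨hlt, h⟩))
    · exact .inl (strictConvexOn_drift_sub (.inl ⟨hgt, h⟩))
    · exact .inr (strictConcaveOn_drift_sub (.inl ⟨hgt, h⟩))
  rcases hcase with h | h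
  · exact ne_zero_of_strictConvexOn hcont h h1 hx0 hxy hy1 (sub_eq_zero.2 hfx)
      (sub_eq_zero.2 hfy)
  · exact ne_zero_of_strictConcaveOn hcont h h0 hx0 hxy hy1 (sub_eq_zero.2 hfx)
      (sub_eq_zero.2 hfy)

/-- `g` has Lipschitz constant `c * |2 * p - 1| < 1`, so two distinct fixed points would be closer
to each other than they are. -/
theorem exists_isUniqueFixedPoint_of_lipschitz (hp : p ∈ Set.Ioo (0 : ℝ) 1)
    (hf : ∀ x ∈ Set.Icc (0 : ℝ) 1, f x ∈ Set.Icc (0 : ℝ) 1)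
    (hc : ContinuousOn f (Set.Icc 0 1)) {c : ℝ}
    (hlip : ∀ x ∈ Set.Icc (0 : ℝ) 1, ∀ y ∈ Set.Icc (0 : ℝ) 1, |f x - f y| ≤ c * |x - y|)
    (hcp : c * |2 * p - 1| < 1) : ∃ x, IsUniqueFixedPoint (drift p f) x := by
  refine exists_isUniqueFixedPoint hp hf hc fun x hx y hy hxy hfx hfy => ?_
  rw [drift_eq] at hfx hfy
  have h1 : x - y = (2 * p - 1) * (f x - f y) := by linear_combination hfy - hfx
  have h2 : |x - y| ≤ |2 * p - 1| * (c * |x - y|) := by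
    conv_lhs => rw [h1, abs_mul]
    exact mul_le_mul_of_nonneg_left (hlip x hx y hy) (abs_nonneg _)
  have h3 : 0 < |x - y| := abs_pos.2 (sub_ne_zero.2 hxy.ne)
  nlinarith

theorem RegularityCondition.continuousOn {k : ℕ → ℕ} (h : RegularityCondition f k) :
    ContinuousOn f (Set.Icc 0 1) := by
  rcases h with h | ⟨α, L, hα, -, h, -⟩ | h | h
  · exact h.1
  · intro x hx
    rw [ContinuousWithinAt, tendsto_iff_dist_tendsto_zero]
    have hlim : Tendsto (fun y => L * |y - x| ^ α) (𝓝[Set.Icc 0 1] x) (𝓝 0) := by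
      have hcont : Continuous fun y : ℝ => L * |y - x| ^ α :=
        continuous_const.mul ((continuous_id.sub continuous_const).abs.rpow_const
          fun _ => .inr hα.le)
      have := hcont.tendsto x
      simp only [sub_self, abs_zero, Real.zero_rpow hα.ne', mul_zero] at this
      exact this.mono_left nhdsWithin_le_nhds
    refine squeeze_zero' (Eventually.of_forall fun _ => dist_nonneg) ?_ hlim
    filter_upwards [self_mem_nhdsWithin] with y hy
    exact h y hy x hx
  · exact h.1.continuousOn
  · exact h.1.continuousOn

end Drift

/-! ### Martingales with square-summable increments -/

section Martingale

variable {Ω : Type*} {m0 : MeasurableSpace Ω} {μ : Measure Ω} [IsProbabilityMeasure μ]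

/-- Martingale increments are orthogonal, so second moments of the partial sums stay below `∑ b n ^
2`; Doob's convergence theorem applies to this bounded martingale. -/
theorem ae_exists_tendsto_sum_of_condExp_eq_zero {ℱ : Filtration ℕ m0} {d : ℕ → Ω → ℝ}
    {b : ℕ → ℝ} (hd : ∀ n, StronglyMeasurable[ℱ (n + 1)] (d n))
    (hbd : ∀ n, ∀ᵐ ω ∂μ, ‖d n ω‖ ≤ b n) (hcond : ∀ n, μ[d n | ℱ n] =ᵐ[μ] 0)
    (hb : Summable fun n => b n ^ 2) :
    ∀ᵐ ω ∂μ, ∃ c, Tendsto (fun n => ∑ i ∈ Finset.range n, d i ω) atTop (𝓝 c) := by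
  set M : ℕ → Ω → ℝ := fun n ω => ∑ i ∈ Finset.range n, d i ω with hM
  have hsucc : ∀ n, M (n + 1) = M n + d n := fun n => by
    ext ω; simp [hM, Finset.sum_range_succ]
  have hadap : ∀ n, StronglyMeasurable[ℱ n] (M n) := fun n =>
    Finset.stronglyMeasurable_fun_sum _ fun i hi =>
      (hd i).mono (ℱ.mono (Finset.mem_range.1 hi))
  have hMb : ∀ n, ∀ᵐ ω ∂μ, ‖M n ω‖ ≤ ∑ i ∈ Finset.range n, b i := fun n => by
    filter_upwards [ae_all_iff.2 hbd] with ω hω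
    exact (norm_sum_le _ _).trans (Finset.sum_le_sum fun i _ => hω i)
  have hdm : ∀ n, AEStronglyMeasurable (d n) μ := fun n =>
    ((hd n).mono (ℱ.le _)).aestronglyMeasurable
  have hMm : ∀ n, AEStronglyMeasurable (M n) μ := fun n =>
    ((hadap n).mono (ℱ.le _)).aestronglyMeasurable
  have hdint : ∀ n, Integrable (d n) μ := fun n => .of_bound (hdm n) _ (hbd n)
  have hMint : ∀ n, Integrable (M n) μ := fun n => .of_bound (hMm n) _ (hMb n)
  have hmart : Martingale M ℱ μ := by
    refine martingale_nat hadap hMint fun n => ?_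
    have h1 := condExp_add (hMint n) (hdint n) (ℱ n)
    rw [condExp_of_stronglyMeasurable (ℱ.le n) (hadap n) (hMint n)] at h1
    rw [hsucc]
    filter_upwards [h1, hcond n] with ω h1 h2
    simp [h1, h2]
  have hMdint : ∀ n, Integrable (M n * d n) μ := fun n =>
    (hdint n).bdd_mul (hMm n) (hMb n)
  have hMsq : ∀ n, Integrable (fun ω => M n ω ^ 2) μ := fun n => by
    simpa [sq] using (hMint n).bdd_mul (hMm n) (hMb n)
  have hdsq : ∀ n, Integrable (fun ω => d n ω ^ 2) μ := fun n => by
    simpa [sq] using (hdint n).bdd_mul (hdm n) (hbd n)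
  have horth : ∀ n, ∫ ω, M n ω * d n ω ∂μ = 0 := fun n => by
    have h1 := condExp_stronglyMeasurable_mul_of_bound (ℱ.le n) (hadap n) (hdint n) _ (hMb n)
    have h2 : μ[M n * d n | ℱ n] =ᵐ[μ] 0 := by
      filter_upwards [h1, hcond n] with ω h1 h2
      simp [h1, h2]
    have h3 := integral_condExp (μ := μ) (f := M n * d n) (ℱ.le n)
    rw [integral_congr_ae h2] at h3
    simpa using h3.symm
  have hsq : ∀ n, ∫ ω, M n ω ^ 2 ∂μ ≤ ∑ i ∈ Finset.range n, b i ^ 2 := fun n => by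
    induction n with
    | zero => simp [hM]
    | succ n ih =>
      have h1 : (fun ω => M (n + 1) ω ^ 2) =
          fun ω => (M n ω ^ 2 + 2 * (M n ω * d n ω)) + d n ω ^ 2 := by
        ext ω; rw [hsucc]; simp only [Pi.add_apply]; ring
      have h2 : ∫ ω, d n ω ^ 2 ∂μ ≤ b n ^ 2 := by
        have : ∫ ω, d n ω ^ 2 ∂μ ≤ ∫ _, b n ^ 2 ∂μ := by
          refine integral_mono_ae (hdsq n) (integrable_const _) ?_
          filter_upwards [hbd n] with ω hω
          exact sq_le_sq' (abs_le.1 hω).1 (abs_le.1 hω).2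
        simpa using this
      have h4 : Integrable (fun ω => 2 * (M n ω * d n ω)) μ := (hMdint n).const_mul 2
      rw [h1, integral_add (f := fun ω => M n ω ^ 2 + 2 * (M n ω * d n ω)) ((hMsq n).add h4)
        (hdsq n), integral_add (hMsq n) h4,
        integral_const_mul, horth, Finset.sum_range_succ]
      linarith
  -- The bound `|t| ≤ 1 + t ^ 2` turns the second moment estimate into the required `L¹` bound.
  refine hmart.submartingale.exists_ae_tendsto_of_bdd
    (R := (1 + ∑' n, b n ^ 2).toNNReal) fun n => ?_
  rw [eLpNorm_one_eq_lintegral_enorm, ← ofReal_integral_norm_eq_lintegral_enorm (hMint n)]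
  refine ENNReal.ofReal_le_ofReal ?_
  calc ∫ ω, ‖M n ω‖ ∂μ ≤ ∫ ω, (1 + M n ω ^ 2) ∂μ := by
        refine integral_mono (hMint n).norm ((integrable_const _).add (hMsq n)) fun ω => ?_
        simp only [Real.norm_eq_abs]
        nlinarith [sq_abs (M n ω), sq_nonneg (|M n ω| - 1), abs_nonneg (M n ω)]
    _ = 1 + ∫ ω, M n ω ^ 2 ∂μ := by
        rw [integral_add (integrable_const _) (hMsq n)]; simp
    _ ≤ 1 + ∑' n, b n ^ 2 := by
        gcongr
        exact (hsq n).trans (hb.sum_le_tsum _ fun i _ => sq_nonneg _)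

/-- The conditional second moment of a sum of conditionally orthogonal variables. -/
theorem condExp_sq_sum_le {ι : Type*} [Fintype ι] {m : MeasurableSpace Ω} (hm : m ≤ m0)
    {W : ι → Ω → ℝ} (hW : ∀ i, AEStronglyMeasurable[m0] (W i) μ) (hbd : ∀ i ω, ‖W i ω‖ ≤ 1)
    (horth : ∀ i j, i ≠ j → μ[W i * W j | m] =ᵐ[μ] 0) :
    μ[fun ω => (∑ i, W i ω) ^ 2 | m] ≤ᵐ[μ] fun _ => (Fintype.card ι : ℝ) := by
  classical
  have hWint : ∀ i, Integrable (W i) μ := fun i => .of_bound (hW i) 1 (.of_forall (hbd i))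
  have hWW : ∀ i j, Integrable (W i * W j) μ := fun i j =>
    (hWint j).bdd_mul (hW i) (.of_forall (hbd i))
  -- Expanded over ordered pairs, only the diagonal survives, each entry contributing at most `1`.
  have hexp : (fun ω => (∑ i, W i ω) ^ 2) =
      ∑ x ∈ (Finset.univ : Finset (ι × ι)), W x.1 * W x.2 := by
    ext ω
    simp only [sq, Finset.sum_mul_sum, Finset.sum_apply, Pi.mul_apply,
      ← Finset.univ_product_univ, Finset.sum_product]
  have hdiag : ∀ i, μ[W i * W i | m] ≤ᵐ[μ] fun _ => 1 := fun i => by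
    have h := condExp_mono (m := m) (hWW i i) (integrable_const (1 : ℝ)) (.of_forall fun ω => by
      have h1 := hbd i ω
      simp only [Pi.mul_apply]
      rw [Real.norm_eq_abs, ← sq_le_one_iff_abs_le_one] at h1
      linarith [sq (W i ω)])
    rwa [condExp_const hm] at h
  have hpair : ∀ x : ι × ι, μ[W x.1 * W x.2 | m] ≤ᵐ[μ]
      fun _ => if x.1 = x.2 then 1 else 0 := fun x => by
    by_cases hx : x.1 = x.2
    · simpa [hx] using hdiag x.2
    · filter_upwards [horth _ _ hx] with ω hω
      simp [hω, hx]
  rw [hexp]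
  filter_upwards [condExp_finsetSum (s := Finset.univ) (f := fun x : ι × ι => W x.1 * W x.2)
    (fun x _ => hWW x.1 x.2) m, ae_all_iff.2 hpair] with ω h1 h2
  rw [h1, Finset.sum_apply]
  refine (Finset.sum_le_sum fun x _ => h2 x).trans ?_
  rw [← Finset.univ_product_univ, Finset.sum_product]
  simp

end Martingale

/-- A continuous function on `[0, 1]` differs at two points by at most `ε` plus a multiple of their
squared distance. -/
theorem exists_abs_sub_le_add_mul_sq {G : ℝ → ℝ} (hG : ContinuousOn G (Set.Icc 0 1))
    (hG01 : ∀ x ∈ Set.Icc (0 : ℝ) 1, G x ∈ Set.Icc (0 : ℝ) 1) {ε : ℝ} (hε : 0 < ε) :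
    ∃ C, ∀ x ∈ Set.Icc (0 : ℝ) 1, ∀ y ∈ Set.Icc (0 : ℝ) 1,
      |G x - G y| ≤ ε + C * (x - y) ^ 2 := by
  obtain ⟨δ, hδ, h⟩ := Metric.uniformContinuousOn_iff.1
    (isCompact_Icc.uniformContinuousOn_of_continuous hG) ε hε
  -- With this constant the quadratic term is at least `1` once `δ ≤ |x - y|`, and `G` oscillates by
  -- at most `1`.
  refine ⟨1 / δ ^ 2, fun x hx y hy => ?_⟩
  rcases lt_or_ge |x - y| δ with hlt | hge
  · have h1 := (h x hx y hy hlt).le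
    rw [Real.dist_eq] at h1
    have : 0 ≤ 1 / δ ^ 2 * (x - y) ^ 2 := by positivity
    linarith
  · have h1 : 1 ≤ 1 / δ ^ 2 * (x - y) ^ 2 := by
      rw [one_div_mul_eq_div, one_le_div (by positivity), ← sq_abs (x - y)]
      gcongr
    have h2 : |G x - G y| ≤ 1 := by
      obtain ⟨a, b⟩ := hG01 x hx
      obtain ⟨c, d⟩ := hG01 y hy
      rw [abs_le]; constructor <;> linarith
    linarith

/-! ### The proportion of `+1` steps -/

/-- The indicator of the event that the `n`-th step is `+1`. -/
def plusStep {Ω : Type*} (X : ℕ → Ω → ℝ) (n : ℕ) : Ω → ℝ :=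
  Set.indicator {ω | X n ω = 1} fun _ => 1

/-- The proportion of `+1` among the first `n` steps. -/
def plusFraction {Ω : Type*} (X : ℕ → Ω → ℝ) (n : ℕ) (ω : Ω) : ℝ :=
  (∑ i ∈ Finset.Icc 1 n, plusStep X i ω) / n

/-- The centred indicator of the event that the `i`-th draw at time `n` is `j`. -/
def centredDraw {Ω : Type*} {k : ℕ → ℕ} (U : (n : ℕ) → Fin (k n) → Ω → ℕ)
    (n : ℕ) (i : Fin (k n)) (j : ℕ) (ω : Ω) : ℝ :=
  (if U n i ω = j then 1 else 0) - 1 / n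

theorem stronglyMeasurable_centredDraw {Ω : Type*} {k : ℕ → ℕ}
    (U : (n : ℕ) → Fin (k n) → Ω → ℕ) (n : ℕ) (i : Fin (k n)) (j : ℕ) :
    StronglyMeasurable[sampleField U n] (centredDraw U n i j) := by
  have hle : MeasurableSpace.comap (U n i) ⊤ ≤ sampleField U n :=
    le_iSup (fun i : Fin (k n) => MeasurableSpace.comap (U n i) ⊤) i
  have h : Measurable[MeasurableSpace.comap (U n i) ⊤] (centredDraw U n i j) :=
    (measurable_from_top (f := fun u : ℕ => (if u = j then (1 : ℝ) else 0) - 1 / n)).comp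
      (comap_measurable (U n i))
  exact (h.mono hle le_rfl).stronglyMeasurable

section Basic

variable {Ω : Type*} (X : ℕ → Ω → ℝ)

theorem plusStep_mem_Icc (n : ℕ) (ω : Ω) : plusStep X n ω ∈ Set.Icc (0 : ℝ) 1 := by
  unfold plusStep Set.indicator
  split_ifs <;> simp

theorem plusFraction_mem_Icc (n : ℕ) (ω : Ω) : plusFraction X n ω ∈ Set.Icc (0 : ℝ) 1 := by
  refine ⟨div_nonneg (Finset.sum_nonneg fun i _ => (plusStep_mem_Icc X i ω).1) n.cast_nonneg,
    div_le_one_of_le₀ ?_ n.cast_nonneg⟩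
  refine (Finset.sum_le_sum fun i _ => (plusStep_mem_Icc X i ω).2).trans ?_
  simp

theorem plusFraction_succ (n : ℕ) (ω : Ω) :
    plusFraction X (n + 1) ω = plusFraction X n ω +
      1 / ((n : ℝ) + 1) * (plusStep X (n + 1) ω - plusFraction X n ω) := by
  unfold plusFraction
  rw [Finset.sum_Icc_succ_top (by omega)]
  -- At `n = 0` the fraction is `0 / 0 = 0`, and the recursion still holds.
  rcases Nat.eq_zero_or_pos n with rfl | hn
  · simp
  · have h1 : (n : ℝ) ≠ 0 := by positivity
    have h2 : (n : ℝ) + 1 ≠ 0 := by positivity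
    push_cast
    field_simp
    ring

theorem plusCount_div_mem_Icc {k : ℕ → ℕ} (U : (n : ℕ) → Fin (k n) → Ω → ℕ) (n : ℕ) (ω : Ω) :
    plusCount X U n ω / k n ∈ Set.Icc (0 : ℝ) 1 := by
  have h : ∀ i : Fin (k n), Set.indicator {ω' | X (U n i ω') ω' = 1} (fun _ => (1 : ℝ)) ω ∈
      Set.Icc (0 : ℝ) 1 := fun i => by
    unfold Set.indicator
    split_ifs <;> simp
  refine ⟨div_nonneg (Finset.sum_nonneg fun i _ => (h i).1) (Nat.cast_nonneg _),
    div_le_one_of_le₀ ?_ (Nat.cast_nonneg _)⟩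
  refine (Finset.sum_le_sum fun i _ => (h i).2).trans ?_
  simp

theorem history_mono {k : ℕ → ℕ} (U : (n : ℕ) → Fin (k n) → Ω → ℕ) :
    Monotone (history X U) := fun _ _ hmn =>
  sup_le_sup (biSup_mono fun _ hi => Finset.Icc_subset_Icc_right hmn hi)
    (biSup_mono fun _ hi => Finset.Ico_subset_Ico_right hmn hi)

theorem stronglyMeasurable_plusStep {k : ℕ → ℕ} (U : (n : ℕ) → Fin (k n) → Ω → ℕ) {i n : ℕ}
    (hi : i ∈ Finset.Icc 1 n) : StronglyMeasurable[history X U n] (plusStep X i) := by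
  refine StronglyMeasurable.indicator stronglyMeasurable_const ?_
  have hle : MeasurableSpace.comap (X i) (borel ℝ) ≤ history X U n :=
    (le_biSup (fun m => MeasurableSpace.comap (X m) (borel ℝ)) hi).trans le_sup_left
  refine hle _ ⟨{1}, ?_, rfl⟩
  rw [← BorelSpace.measurable_eq (α := ℝ)]
  exact measurableSet_singleton 1

theorem stronglyMeasurable_plusFraction {k : ℕ → ℕ} (U : (n : ℕ) → Fin (k n) → Ω → ℕ) (n : ℕ) :
    StronglyMeasurable[history X U n] (plusFraction X n) := by
  have h : StronglyMeasurable[history X U n] fun ω => ∑ i ∈ Finset.Icc 1 n, plusStep X i ω :=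
    Finset.stronglyMeasurable_fun_sum _ fun i hi => stronglyMeasurable_plusStep X U hi
  have h2 : plusFraction X n = fun ω => (∑ i ∈ Finset.Icc 1 n, plusStep X i ω) * (n : ℝ)⁻¹ := by
    ext ω; rw [plusFraction, div_eq_mul_inv]
  rw [h2]
  exact h.mul_const _

/-- A sampled step depends on both the past and the draw. This sum separates them: each term is a
past-measurable factor times a sample-measurable one. -/
theorem sum_plusStep_mul_centredDraw {k : ℕ → ℕ} (U : (n : ℕ) → Fin (k n) → Ω → ℕ) (n : ℕ)
    (i : Fin (k n)) (ω : Ω) :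
    ∑ j ∈ Finset.Icc 1 n, plusStep X j ω * centredDraw U n i j ω =
      (if U n i ω ∈ Finset.Icc 1 n then plusStep X (U n i ω) ω else 0) - plusFraction X n ω := by
  simp only [centredDraw, mul_sub, Finset.sum_sub_distrib, mul_ite, mul_one, mul_zero,
    Finset.sum_ite_eq, mul_one_div, ← Finset.sum_div, plusFraction]

end Basic

/-! ### Filtration of the walk and almost sure values of its draws and steps -/

namespace IsWalkWithReplacement

variable {Ω : Type*} [mΩ : MeasurableSpace Ω] {μ : Measure Ω}
  {p q : ℝ} {f : ℝ → ℝ} {k : ℕ → ℕ} {X : ℕ → Ω → ℝ} {U : (n : ℕ) → Fin (k n) → Ω → ℕ}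

theorem sampleField_le (hX : IsWalkWithReplacement μ p q f k X U) (n : ℕ) :
    sampleField U n ≤ mΩ :=
  iSup_le fun i => (hX.measurable_sample n i).comap_le

theorem history_le (hX : IsWalkWithReplacement μ p q f k X U) (n : ℕ) :
    history X U n ≤ mΩ := by
  refine sup_le (iSup₂_le fun m _ => ?_) (iSup₂_le fun m _ => hX.sampleField_le m)
  have h := (hX.measurable_step m).comap_le
  rwa [BorelSpace.measurable_eq (α := ℝ)] at h

/-- The filtration of the walk. -/
def filtration (hX : IsWalkWithReplacement μ p q f k X U) : Filtration ℕ mΩ where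
  seq := history X U
  mono' := history_mono X U
  le' := hX.history_le

theorem measurable_plusStep (hX : IsWalkWithReplacement μ p q f k X U) (n : ℕ) :
    Measurable (plusStep X n) :=
  measurable_const.indicator (hX.measurable_step n (measurableSet_singleton 1))

variable [IsProbabilityMeasure μ]

theorem ae_sample_mem (hX : IsWalkWithReplacement μ p q f k X U) {n : ℕ} (hn : 1 ≤ n)
    (i : Fin (k n)) : ∀ᵐ ω ∂μ, U n i ω ∈ Finset.Icc 1 n := by
  have hm : ∀ j, MeasurableSet {ω | U n i ω = j} := fun j =>
    hX.measurable_sample n i (measurableSet_singleton j)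
  have h1 : μ.real {ω | U n i ω ∈ Finset.Icc 1 n} = 1 := by
    have hset : {ω | U n i ω ∈ Finset.Icc 1 n} =
        ⋃ j ∈ Finset.Icc 1 n, {ω | U n i ω = j} := by
      ext ω; simp
    rw [hset, measureReal_biUnion_finset (fun a _ b _ hab => Set.disjoint_left.2
      fun ω h1 h2 => hab (h1.symm.trans h2)) (fun j _ => hm j),
      Finset.sum_congr rfl (hX.sample_uniform n hn i)]
    have : (n : ℝ) ≠ 0 := by positivity
    simp [this]
  exact (mem_ae_iff_prob_eq_one (hX.measurable_sample n i (Finset.Icc 1 n).measurableSet)).2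
    ((ENNReal.toReal_eq_one_iff _).1 h1)

/-- The two conditional probabilities add up to `1`; integrating them shows that the values `±1`
carry full mass. -/
theorem ae_step_eq (hX : IsWalkWithReplacement μ p q f k X U) {n : ℕ} (hn : 1 ≤ n) :
    ∀ᵐ ω ∂μ, X n ω = 1 ∨ X n ω = -1 := by
  have hp := hX.measurable_step n (measurableSet_singleton 1)
  have hm := hX.measurable_step n (measurableSet_singleton (-1))
  have hsum : μ.real {ω | X n ω = 1} + μ.real {ω | X n ω = -1} = 1 := by
    rcases Nat.exists_eq_add_of_le' hn with ⟨n, rfl⟩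
    rcases Nat.eq_zero_or_pos n with rfl | hn'
    · rw [zero_add, hX.first_plus, hX.first_minus]; ring
    · have hle := sup_le (hX.history_le n) (hX.sampleField_le n)
      have h1 := integral_condExp (μ := μ)
        (f := Set.indicator {ω | X (n + 1) ω = 1} (fun _ => (1 : ℝ))) hle
      have h2 := integral_condExp (μ := μ)
        (f := Set.indicator {ω | X (n + 1) ω = -1} (fun _ => (1 : ℝ))) hle
      rw [integral_indicator_const (1 : ℝ) (s := {ω | X (n + 1) ω = 1}) hp] at h1
      rw [integral_indicator_const (1 : ℝ) (s := {ω | X (n + 1) ω = -1}) hm] at h2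
      simp only [smul_eq_mul, mul_one] at h1 h2
      rw [← h1, ← h2, ← integral_add integrable_condExp integrable_condExp]
      have h3 : (fun ω =>
          (μ[Set.indicator {ω | X (n + 1) ω = 1} (fun _ => (1 : ℝ)) |
            history X U n ⊔ sampleField U n]) ω +
          (μ[Set.indicator {ω | X (n + 1) ω = -1} (fun _ => (1 : ℝ)) |
            history X U n ⊔ sampleField U n]) ω) =ᵐ[μ] fun _ => 1 := by
        filter_upwards [hX.step_plus n hn', hX.step_minus n hn'] with ω h1 h2
        rw [h1, h2]; ring
      rw [integral_congr_ae h3]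
      simp
  have hdisj : Disjoint {ω | X n ω = 1} {ω | X n ω = -1} :=
    Set.disjoint_left.2 fun ω h1 h2 => by
      simp only [Set.mem_ofPred_eq] at h1 h2
      linarith
  rw [← measureReal_union hdisj hm] at hsum
  exact (mem_ae_iff_prob_eq_one (hp.union hm)).2 ((ENNReal.toReal_eq_one_iff _).1 hsum)

/-- Almost surely, the position is determined by the proportion of `+1` steps. -/
theorem ae_position_div_eq (hX : IsWalkWithReplacement μ p q f k X U) :
    ∀ᵐ ω ∂μ, ∀ n : ℕ, 1 ≤ n → position X n ω / n = 2 * plusFraction X n ω - 1 := by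
  have h : ∀ᵐ ω ∂μ, ∀ n : ℕ, 1 ≤ n → X n ω = 1 ∨ X n ω = -1 :=
    ae_all_iff.2 fun n => by
      by_cases hn : 1 ≤ n
      · filter_upwards [hX.ae_step_eq hn] with ω hω _ using hω
      · exact .of_forall fun _ h => absurd h hn
  filter_upwards [h] with ω hω n hn
  have h1 : position X n ω = 2 * ∑ i ∈ Finset.Icc 1 n, plusStep X i ω - n := by
    have h2 : ∀ i ∈ Finset.Icc 1 n, X i ω = 2 * plusStep X i ω - 1 := fun i hi => by
      rcases hω i (Finset.mem_Icc.1 hi).1 with h | h <;> simp [plusStep, Set.indicator, h] <;>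
        norm_num
    rw [position, Finset.sum_congr rfl h2, Finset.sum_sub_distrib, ← Finset.mul_sum]
    simp
  have h3 : (n : ℝ) ≠ 0 := by positivity
  rw [h1, plusFraction]
  field_simp

/-! ### The conditional law of the sample -/

theorem integral_centredDraw (hX : IsWalkWithReplacement μ p q f k X U) {n : ℕ} (hn : 1 ≤ n)
    (i : Fin (k n)) {j : ℕ} (hj : j ∈ Finset.Icc 1 n) :
    ∫ ω, centredDraw U n i j ω ∂μ = 0 := by
  have hm : MeasurableSet {ω | U n i ω = j} :=
    hX.measurable_sample n i (measurableSet_singleton j)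
  have h1 : (fun ω => if U n i ω = j then (1 : ℝ) else 0) =
      Set.indicator {ω | U n i ω = j} fun _ => (1 : ℝ) := by
    ext ω; simp [Set.indicator]
  have h2 : Integrable (fun ω => if U n i ω = j then (1 : ℝ) else 0) μ := by
    rw [h1]; exact (integrable_const _).indicator hm
  unfold centredDraw
  rw [integral_sub h2 (integrable_const _), h1, integral_indicator_const _ hm,
    hX.sample_uniform n hn i j hj]
  simp

/-- Independence from the past reduces this to a plain expectation, which factors over distinct
draws. One centred factor suffices, so only `j` has to be in range. -/
theorem condExp_centredDraw_mul (hX : IsWalkWithReplacement μ p q f k X U) {n : ℕ} (hn : 1 ≤ n)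
    {i l : Fin (k n)} (hil : i ≠ l) {j j' : ℕ} (hj : j ∈ Finset.Icc 1 n) :
    μ[centredDraw U n i j * centredDraw U n l j' | history X U n] =ᵐ[μ] 0 := by
  have h1 := condExp_indep_eq (hX.sampleField_le n) (hX.history_le n)
    ((stronglyMeasurable_centredDraw U n i j).mul
      (stronglyMeasurable_centredDraw U n l j')) (hX.sample_indep_history n hn)
  have h2 : IndepFun (centredDraw U n i j) (centredDraw U n l j') μ :=
    ((hX.sample_iIndep n hn).indepFun hil).comp
      (φ := fun u : ℕ => (if u = j then (1 : ℝ) else 0) - 1 / n)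
      (ψ := fun u : ℕ => (if u = j' then (1 : ℝ) else 0) - 1 / n)
      measurable_from_top measurable_from_top
  have h3 := h2.integral_fun_mul_eq_mul_integral
    ((stronglyMeasurable_centredDraw U n i j).mono (hX.sampleField_le n)).aestronglyMeasurable
    ((stronglyMeasurable_centredDraw U n l j').mono (hX.sampleField_le n)).aestronglyMeasurable
  rw [hX.integral_centredDraw hn i hj, zero_mul] at h3
  filter_upwards [h1] with ω hω
  rw [hω]
  exact h3

theorem ae_sq_plusCount_div_sub_eq (hX : IsWalkWithReplacement μ p q f k X U) {n : ℕ} (hn : 1 ≤ n)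
    (hk : 1 ≤ k n) :
    (fun ω => (plusCount X U n ω / k n - plusFraction X n ω) ^ 2) =ᵐ[μ]
      ((k n : ℝ) ^ 2)⁻¹ • fun ω => (∑ i : Fin (k n), ∑ j ∈ Finset.Icc 1 n,
        plusStep X j ω * centredDraw U n i j ω) ^ 2 := by
  filter_upwards [ae_all_iff.2 (hX.ae_sample_mem hn)] with ω hω
  have h1 : plusCount X U n ω = ∑ i : Fin (k n), plusStep X (U n i ω) ω := rfl
  have hk' : (k n : ℝ) ≠ 0 := by positivity
  simp only [Pi.smul_apply, smul_eq_mul, sum_plusStep_mul_centredDraw, hω, if_true,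
    Finset.sum_sub_distrib, ← h1, Finset.sum_const, Finset.card_univ, Fintype.card_fin,
    nsmul_eq_mul]
  field_simp

/-- The deviation is the average of `k n` conditionally orthogonal variables bounded by `1`, so its
second moment is at most `k n / (k n) ^ 2`. -/
theorem condExp_sq_plusCount_div_sub_le (hX : IsWalkWithReplacement μ p q f k X U) {n : ℕ}
    (hn : 1 ≤ n) (hk : 1 ≤ k n) :
    μ[fun ω => (plusCount X U n ω / k n - plusFraction X n ω) ^ 2 | history X U n] ≤ᵐ[μ]
      fun _ => 1 / (k n : ℝ) := by
  have hI : ∀ j, AEStronglyMeasurable (plusStep X j) μ := fun j =>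
    (hX.measurable_plusStep j).aestronglyMeasurable
  have hD : ∀ i j, AEStronglyMeasurable (centredDraw U n i j) μ := fun i j =>
    ((stronglyMeasurable_centredDraw U n i j).mono (hX.sampleField_le n)).aestronglyMeasurable
  have hDbd : ∀ i j ω, ‖centredDraw U n i j ω‖ ≤ 1 := fun i j ω => by
    have h1 : (1 : ℝ) ≤ n := by exact_mod_cast hn
    have h2 : 1 / (n : ℝ) ≤ 1 := by rw [div_le_one (by positivity)]; exact h1
    have h3 : 0 ≤ 1 / (n : ℝ) := by positivity
    rw [Real.norm_eq_abs, abs_le, centredDraw]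
    split_ifs <;> constructor <;> linarith
  have hIbd : ∀ j ω, ‖plusStep X j ω‖ ≤ 1 := fun j ω => by
    rw [Real.norm_eq_abs, abs_of_nonneg (plusStep_mem_Icc X j ω).1]
    exact (plusStep_mem_Icc X j ω).2
  have hDD : ∀ i l j j', Integrable (centredDraw U n i j * centredDraw U n l j') μ :=
    fun i l j j' => (Integrable.of_bound (hD l j') 1 (.of_forall (hDbd l j'))).bdd_mul (hD i j)
      (.of_forall (hDbd i j))
  have hIIbd : ∀ j j' ω, ‖(plusStep X j * plusStep X j') ω‖ ≤ 1 := fun j j' ω => by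
    rw [Pi.mul_apply, norm_mul]
    exact mul_le_one₀ (hIbd j ω) (norm_nonneg _) (hIbd j' ω)
  have hsq := condExp_sq_sum_le (μ := μ) (hX.history_le n)
    (W := fun (i : Fin (k n)) ω =>
      ∑ j ∈ Finset.Icc 1 n, plusStep X j ω * centredDraw U n i j ω)
    (fun i => Finset.aestronglyMeasurable_fun_sum _ fun j _ => (hI j).mul (hD i j))
    (fun i ω => by
      rw [sum_plusStep_mul_centredDraw, Real.norm_eq_abs, abs_le]
      obtain ⟨h1, h2⟩ := plusFraction_mem_Icc X n ω
      obtain ⟨h3, h4⟩ := plusStep_mem_Icc X (U n i ω) ω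
      split_ifs <;> constructor <;> linarith)
    (fun i l hil => by
      have hexp : ((fun ω => ∑ j ∈ Finset.Icc 1 n, plusStep X j ω * centredDraw U n i j ω) *
          fun ω => ∑ j ∈ Finset.Icc 1 n, plusStep X j ω * centredDraw U n l j ω) =
          ∑ x ∈ Finset.Icc 1 n ×ˢ Finset.Icc 1 n, (plusStep X x.1 * plusStep X x.2) *
            (centredDraw U n i x.1 * centredDraw U n l x.2) := by
        ext ω
        simp only [Pi.mul_apply, Finset.sum_apply, Finset.sum_mul_sum, Finset.sum_product]
        exact Finset.sum_congr rfl fun a _ => Finset.sum_congr rfl fun b _ => by ring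
      have hterm : ∀ x ∈ Finset.Icc 1 n ×ˢ Finset.Icc 1 n,
          μ[(plusStep X x.1 * plusStep X x.2) *
            (centredDraw U n i x.1 * centredDraw U n l x.2) | history X U n] =ᵐ[μ] 0 := by
        intro x hx
        obtain ⟨hx1, hx2⟩ := Finset.mem_product.1 hx
        have h1 := condExp_stronglyMeasurable_mul_of_bound (hX.history_le n)
          ((stronglyMeasurable_plusStep X U hx1).mul (stronglyMeasurable_plusStep X U hx2))
          (hDD i l x.1 x.2) 1 (.of_forall (hIIbd x.1 x.2))
        filter_upwards [h1, hX.condExp_centredDraw_mul hn hil (j' := x.2) hx1] with ω h1 h2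
        rw [h1, Pi.mul_apply, h2]
        simp
      rw [hexp]
      filter_upwards [condExp_finsetSum (s := Finset.Icc 1 n ×ˢ Finset.Icc 1 n)
        (f := fun x : ℕ × ℕ => (plusStep X x.1 * plusStep X x.2) *
            (centredDraw U n i x.1 * centredDraw U n l x.2))
        (fun x _ => (hDD i l x.1 x.2).bdd_mul ((hI _).mul (hI _))
          (.of_forall (hIIbd x.1 x.2))) (history X U n),
        (ae_ball_iff (Finset.countable_toSet _)).2 hterm] with ω h1 h2
      rw [h1, Finset.sum_apply]
      exact Finset.sum_eq_zero h2)
  filter_upwards [hsq, condExp_congr_ae (m := history X U n) (hX.ae_sq_plusCount_div_sub_eq hn hk),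
    condExp_smul (μ := μ) ((k n : ℝ) ^ 2)⁻¹ (fun ω => (∑ i : Fin (k n),
      ∑ j ∈ Finset.Icc 1 n, plusStep X j ω * centredDraw U n i j ω) ^ 2) (history X U n)]
    with ω h1 h2 h3
  rw [h2, h3, Pi.smul_apply, smul_eq_mul]
  have hk' : (0 : ℝ) < k n := by positivity
  refine (mul_le_mul_of_nonneg_left h1 (by positivity)).trans (le_of_eq ?_)
  rw [Fintype.card_fin]
  field_simp

/-! ### Convergence of the proportion of `+1` steps -/

/-- By the tower property the bias is the conditional mean of `g R - g T`, with `R` the sampled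
fraction; the pointwise bound `hC` and the conditional second moment of `R - T` then control it. -/
theorem condExp_plusStep_sub_drift_le (hX : IsWalkWithReplacement μ p q f k X U)
    (hp : p ∈ Set.Ioo (0 : ℝ) 1) (hf : ∀ x ∈ Set.Icc (0 : ℝ) 1, f x ∈ Set.Icc (0 : ℝ) 1)
    (hc : ContinuousOn f (Set.Icc 0 1)) {ε C : ℝ}
    (hC : ∀ x ∈ Set.Icc (0 : ℝ) 1, ∀ y ∈ Set.Icc (0 : ℝ) 1,
      |drift p f x - drift p f y| ≤ ε + C * (x - y) ^ 2) {n : ℕ} (hn : 1 ≤ n) (hk : 1 ≤ k n) :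
    ∀ᵐ ω ∂μ, |(μ[plusStep X (n + 1) | history X U n]) ω - drift p f (plusFraction X n ω)| ≤
      ε + |C| * (1 / (k n : ℝ)) := by
  have hle := hX.history_le n
  set R : Ω → ℝ := fun ω => plusCount X U n ω / k n
  set T : Ω → ℝ := plusFraction X n
  have hR : ∀ ω, R ω ∈ Set.Icc (0 : ℝ) 1 := plusCount_div_mem_Icc X U n
  have hT : ∀ ω, T ω ∈ Set.Icc (0 : ℝ) 1 := plusFraction_mem_Icc X n
  have hbd : ∀ x ∈ Set.Icc (0 : ℝ) 1, ‖drift p f x‖ ≤ 1 := fun x hx => by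
    rw [Real.norm_eq_abs, abs_of_nonneg (drift_mem_Icc hp hf hx).1]
    exact (drift_mem_Icc hp hf hx).2
  have hstep : μ[plusStep X (n + 1) | history X U n ⊔ sampleField U n] =ᵐ[μ]
      fun ω => drift p f (R ω) := hX.step_plus n hn
  have hgR : Integrable (fun ω => drift p f (R ω)) μ := integrable_condExp.congr hstep
  -- `g` is continuous only on `[0,1]`; since `T` takes values there, `g` may be replaced by a
  -- continuous extension.
  have hgTm : StronglyMeasurable[history X U n] fun ω => drift p f (T ω) := by
    have h1 : Continuous (Set.IccExtend (zero_le_one (α := ℝ))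
        (Set.domRestrict (Set.Icc 0 1) (drift p f))) :=
      (continuousOn_iff_continuous_domRestrict.1 (continuousOn_drift hc)).Icc_extend'
    have h2 := h1.comp_stronglyMeasurable (stronglyMeasurable_plusFraction X U n)
    have h3 : (fun ω => drift p f (T ω)) = fun ω => Set.IccExtend (zero_le_one (α := ℝ))
        (Set.domRestrict (Set.Icc 0 1) (drift p f)) (T ω) := by
      ext ω
      rw [Set.IccExtend_of_mem _ _ (hT ω), Set.domRestrict_apply]
    rw [h3]
    exact h2
  have hgT : Integrable (fun ω => drift p f (T ω)) μ :=
    .of_bound (hgTm.mono hle).aestronglyMeasurable 1 (.of_forall fun ω => hbd _ (hT ω))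
  have htower : μ[plusStep X (n + 1) | history X U n] =ᵐ[μ]
      μ[fun ω => drift p f (R ω) | history X U n] :=
    (condExp_condExp_of_le le_sup_left (sup_le hle (hX.sampleField_le n))).symm.trans
      (condExp_congr_ae hstep)
  have hsqint : Integrable (fun ω => (R ω - T ω) ^ 2) μ := by
    refine .of_bound ?_ 1 (.of_forall fun ω => ?_)
    · refine AEStronglyMeasurable.congr ?_ (hX.ae_sq_plusCount_div_sub_eq hn hk).symm
      refine (AEStronglyMeasurable.pow (Finset.aestronglyMeasurable_fun_sum _ fun i _ =>
        Finset.aestronglyMeasurable_fun_sum _ fun j _ =>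
        (hX.measurable_plusStep j).aestronglyMeasurable.mul
        ((stronglyMeasurable_centredDraw U n i j).mono (hX.sampleField_le n)).aestronglyMeasurable)
        2).const_smul _
    · obtain ⟨h1, h2⟩ := hR ω
      obtain ⟨h3, h4⟩ := hT ω
      rw [Real.norm_eq_abs, abs_of_nonneg (sq_nonneg _), sq_le_one_iff_abs_le_one, abs_le]
      constructor <;> linarith
  have hsub := condExp_sub hgR hgT (history X U n)
  rw [condExp_of_stronglyMeasurable hle hgTm hgT] at hsub
  have hnorm := norm_condExp_le (μ := μ) (m := history X U n)
    ((fun ω => drift p f (R ω)) - fun ω => drift p f (T ω))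
  have hmono := condExp_mono (μ := μ) (m := history X U n)
    (f := fun ω => ‖((fun ω => drift p f (R ω)) - fun ω => drift p f (T ω)) ω‖)
    (g := (fun _ => ε) + |C| • fun ω => (R ω - T ω) ^ 2) (hgR.sub hgT).norm
    ((integrable_const _).add (hsqint.smul |C|)) (.of_forall fun ω => by
      refine (hC _ (hR ω) _ (hT ω)).trans ?_
      have := mul_le_mul_of_nonneg_right (le_abs_self C) (sq_nonneg (R ω - T ω))
      simpa using this)
  have hadd := condExp_add (μ := μ) (integrable_const ε) (hsqint.smul |C|) (history X U n)
  rw [condExp_const hle] at hadd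
  filter_upwards [htower, hsub, hnorm, hmono, hadd,
    condExp_smul (μ := μ) |C| (fun ω => (R ω - T ω) ^ 2) (history X U n),
    hX.condExp_sq_plusCount_div_sub_le hn hk] with ω h1 h2 h3 h4 h5 h6 h7
  rw [h2] at h3
  rw [h5, Pi.add_apply, h6, Pi.smul_apply, smul_eq_mul] at h4
  rw [h1]
  refine (h3.trans h4).trans ?_
  have := mul_le_mul_of_nonneg_left h7 (abs_nonneg C)
  linarith

theorem ae_tendsto_condExp_sub_drift (hX : IsWalkWithReplacement μ p q f k X U)
    (hp : p ∈ Set.Ioo (0 : ℝ) 1) (hf : ∀ x ∈ Set.Icc (0 : ℝ) 1, f x ∈ Set.Icc (0 : ℝ) 1)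
    (hc : ContinuousOn f (Set.Icc 0 1)) (hk : Tendsto k atTop atTop) :
    ∀ᵐ ω ∂μ, Tendsto (fun n => (μ[plusStep X (n + 1) | history X U n]) ω -
      drift p f (plusFraction X n ω)) atTop (𝓝 0) := by
  -- Countably many tolerances `1 / (m + 1)` allow a single null set; for each `m`, `k n → ∞`
  -- removes the term with `C m`.
  choose C hC using fun m : ℕ => exists_abs_sub_le_add_mul_sq
    (continuousOn_drift (p := p) hc) (fun x hx => drift_mem_Icc hp hf hx)
    (Nat.one_div_pos_of_nat (α := ℝ) (n := m))
  have h : ∀ᵐ ω ∂μ, ∀ m n : ℕ, 1 ≤ n → 1 ≤ k n →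
      |(μ[plusStep X (n + 1) | history X U n]) ω - drift p f (plusFraction X n ω)| ≤
        1 / ((m : ℝ) + 1) + |C m| * (1 / (k n : ℝ)) := by
    refine ae_all_iff.2 fun m => ae_all_iff.2 fun n => ?_
    by_cases hn : 1 ≤ n ∧ 1 ≤ k n
    · filter_upwards [hX.condExp_plusStep_sub_drift_le hp hf hc (hC m) hn.1 hn.2] with ω hω _ _
        using hω
    · exact .of_forall fun ω h1 h2 => absurd ⟨h1, h2⟩ hn
  filter_upwards [h] with ω hω
  rw [Metric.tendsto_nhds]
  intro ε hε
  obtain ⟨m, hm⟩ := exists_nat_one_div_lt (half_pos hε)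
  have hlim : Tendsto (fun n => |C m| * (1 / (k n : ℝ))) atTop (𝓝 0) := by
    simpa using ((tendsto_natCast_atTop_atTop (R := ℝ)).comp hk).inv_tendsto_atTop.const_mul |C m|
  filter_upwards [hlim.eventually_lt_const (half_pos hε), eventually_ge_atTop 1,
    hk.eventually_ge_atTop 1] with n h1 h2 h3
  rw [Real.dist_eq, sub_zero]
  have := hω m n h2 h3
  linarith

theorem ae_tendsto_plusFraction (hX : IsWalkWithReplacement μ p q f k X U)
    (hp : p ∈ Set.Ioo (0 : ℝ) 1) (hf : ∀ x ∈ Set.Icc (0 : ℝ) 1, f x ∈ Set.Icc (0 : ℝ) 1)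
    (hc : ContinuousOn f (Set.Icc 0 1)) (hk : Tendsto k atTop atTop) {x : ℝ}
    (hx : IsUniqueFixedPoint (drift p f) x) :
    ∀ᵐ ω ∂μ, Tendsto (fun n => plusFraction X n ω) atTop (𝓝 x) := by
  set E : ℕ → Ω → ℝ := fun n => μ[plusStep X (n + 1) | history X U n]
  have hYint : ∀ n, Integrable (plusStep X n) μ := fun n =>
    .of_bound (hX.measurable_plusStep n).aestronglyMeasurable 1 (.of_forall fun ω => by
      rw [Real.norm_eq_abs, abs_of_nonneg (plusStep_mem_Icc X n ω).1]
      exact (plusStep_mem_Icc X n ω).2)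
  have hE : ∀ n, ∀ᵐ ω ∂μ, E n ω ∈ Set.Icc (0 : ℝ) 1 := fun n => by
    have h0 := condExp_mono (m := history X U n) (integrable_const (0 : ℝ)) (hYint (n + 1))
      (.of_forall fun ω => (plusStep_mem_Icc X (n + 1) ω).1)
    have h1 := condExp_mono (m := history X U n) (hYint (n + 1)) (integrable_const (1 : ℝ))
      (.of_forall fun ω => (plusStep_mem_Icc X (n + 1) ω).2)
    rw [condExp_const (hX.history_le n)] at h0 h1
    filter_upwards [h0, h1] with ω h0 h1 using ⟨h0, h1⟩
  have hnoise := ae_exists_tendsto_sum_of_condExp_eq_zero (μ := μ) (ℱ := hX.filtration)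
    (d := fun n => (1 / ((n : ℝ) + 1)) • (plusStep X (n + 1) - E n))
    (b := fun n => 1 / ((n : ℝ) + 1))
    (fun n => ((stronglyMeasurable_plusStep X U (Finset.mem_Icc.2 ⟨by omega, le_rfl⟩)).sub
      (stronglyMeasurable_condExp.mono (history_mono X U n.le_succ))).const_smul _)
    (fun n => by
      filter_upwards [hE n] with ω hω
      obtain ⟨h1, h2⟩ := plusStep_mem_Icc X (n + 1) ω
      rw [Pi.smul_apply, norm_smul, Real.norm_of_nonneg (by positivity)]
      refine mul_le_of_le_one_right (by positivity) ?_
      rw [Real.norm_eq_abs, abs_le, Pi.sub_apply]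
      constructor <;> linarith [hω.1, hω.2])
    (fun n => by
      have h1 := condExp_sub (hYint (n + 1)) (integrable_condExp (μ := μ)
        (m := history X U n) (f := plusStep X (n + 1))) (history X U n)
      rw [condExp_of_stronglyMeasurable (hX.history_le n) stronglyMeasurable_condExp
        integrable_condExp] at h1
      filter_upwards [condExp_smul (μ := μ) (1 / ((n : ℝ) + 1)) (plusStep X (n + 1) - E n)
        (history X U n), h1] with ω h2 h1
      refine h2.trans ?_
      rw [Pi.smul_apply]
      refine (congrArg _ h1).trans ?_
      simp)
    (by
      have h := (summable_nat_add_iff 1).2 (Real.summable_one_div_nat_pow.2 one_lt_two)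
      simpa [one_div, inv_pow] using h)
  filter_upwards [hnoise, hX.ae_tendsto_condExp_sub_drift hp hf hc hk] with ω hω hdrift
  obtain ⟨c, hM⟩ := hω
  set M : ℕ → ℝ := fun n => ∑ i ∈ Finset.range n,
    ((1 / ((i : ℝ) + 1)) • (plusStep X (i + 1) - E i)) ω
  have hM0 : Tendsto (fun n => c - M n) atTop (𝓝 0) := by
    simpa using hM.const_sub c
  -- Adding the remainder `c - M n` of the convergent noise series cancels the martingale difference
  -- in the recursion and vanishes in the limit.
  have hV := tendsto_of_drift (T := fun n => plusFraction X n ω)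
    (V := fun n => plusFraction X n ω + (c - M n)) (a := fun n : ℕ => 1 / ((n : ℝ) + 1))
    (e := fun n => E n ω - drift p f (plusFraction X n ω)) (h := fun y => drift p f y - y)
    (x := x) isCompact_Icc ((continuousOn_drift hc).sub continuousOn_id)
    (fun y hy hxy => sub_neg.2 (hx.drift_lt hp hf hc hy hxy))
    (fun y hy hxy => sub_pos.2 (hx.lt_drift hp hf hc hy hxy))
    (fun n => plusFraction_mem_Icc X n ω) (by simpa using hM0) (fun n => by positivity)
    tendsto_one_div_add_atTop_nhds_zero_nat Real.tendsto_sum_range_one_div_nat_succ_atTop hdrift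
    (.of_forall fun n => by
      have h1 : M (n + 1) = M n + 1 / ((n : ℝ) + 1) * (plusStep X (n + 1) ω - E n ω) :=
        Finset.sum_range_succ _ _
      rw [h1, plusFraction_succ]
      ring)
  simpa using hV.sub hM0

theorem ae_tendsto_position_div (hX : IsWalkWithReplacement μ p q f k X U)
    (hp : p ∈ Set.Ioo (0 : ℝ) 1) (hf : ∀ x ∈ Set.Icc (0 : ℝ) 1, f x ∈ Set.Icc (0 : ℝ) 1)
    (hc : ContinuousOn f (Set.Icc 0 1)) (hk : Tendsto k atTop atTop) {x : ℝ}
    (hx : IsUniqueFixedPoint (drift p f) x) :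
    ∀ᵐ ω ∂μ, Tendsto (fun n : ℕ => position X n ω / n) atTop (𝓝 (2 * x - 1)) := by
  filter_upwards [hX.ae_position_div_eq, hX.ae_tendsto_plusFraction hp hf hc hk hx] with ω h1 h2
  refine ((h2.const_mul 2).sub_const 1).congr' ?_
  filter_upwards [eventually_ge_atTop 1] with n hn
  exact (h1 n hn).symm

end IsWalkWithReplacement

end ElephantWalk

end

theorem theorem3 {Ω : Type*} [MeasurableSpace Ω] (μ : Measure Ω) [IsProbabilityMeasure μ]
    (p q : ℝ) (hp : p ∈ Set.Ioo (0 : ℝ) 1) (hp' : p ≠ 1 / 2) (hq : q ∈ Set.Icc (0 : ℝ) 1)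
    (f : ℝ → ℝ) (hf : ∀ x ∈ Set.Icc (0 : ℝ) 1, f x ∈ Set.Icc (0 : ℝ) 1)
    (k : ℕ → ℕ) (hk : ∀ n, 1 ≤ n → 1 ≤ k n ∧ k n ≤ n)
    (hk_mono : MonotoneOn k (Set.Ici 1)) (hk_top : Tendsto k atTop atTop)
    (X : ℕ → Ω → ℝ) (U : (n : ℕ) → Fin (k n) → Ω → ℕ)
    (hX : ElephantWalk.IsWalkWithReplacement μ p q f k X U)
    (hF : ElephantWalk.RegularityCondition f k) :
    -- a unique fixed point that is attracting
    (∀ x : ℝ, ElephantWalk.IsUniqueFixedPoint (ElephantWalk.drift p f) x →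
      (∀ y ∈ Set.Icc (0 : ℝ) 1, y ≠ x → (ElephantWalk.drift p f y - y) * (y - x) < 0) →
      ∀ᵐ ω ∂μ, Tendsto (fun n : ℕ => ElephantWalk.position X n ω / n) atTop (𝓝 (2 * x - 1))) ∧
    -- uniqueness of the fixed point alone is enough
    (∀ x : ℝ, ElephantWalk.IsUniqueFixedPoint (ElephantWalk.drift p f) x →
      ∀ᵐ ω ∂μ, Tendsto (fun n : ℕ => ElephantWalk.position X n ω / n) atTop (𝓝 (2 * x - 1))) ∧
    -- the three sufficient conditions
    (((ContDiffOn ℝ 1 f (Set.Icc 0 1) ∧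
        ((1 / 2 < p ∧ StrictAntiOn f (Set.Icc 0 1)) ∨
          (p < 1 / 2 ∧ StrictMonoOn f (Set.Icc 0 1)))) ∨
      (ContDiffOn ℝ 2 f (Set.Icc 0 1) ∧
        (StrictConvexOn ℝ (Set.Ioo 0 1) f ∨ StrictConcaveOn ℝ (Set.Ioo 0 1) f)) ∨
      (∃ c : ℝ, (∀ x ∈ Set.Icc (0 : ℝ) 1, ∀ y ∈ Set.Icc (0 : ℝ) 1, |f x - f y| ≤ c * |x - y|) ∧
        c * |2 * p - 1| < 1)) →
      ∃ x : ℝ, ElephantWalk.IsUniqueFixedPoint (ElephantWalk.drift p f) x ∧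
        ∀ᵐ ω ∂μ, Tendsto (fun n : ℕ => ElephantWalk.position X n ω / n) atTop
          (𝓝 (2 * x - 1))) := by
  have hc := hF.continuousOn
  refine ⟨fun x hx _ => hX.ae_tendsto_position_div hp hf hc hk_top hx,
    fun x hx => hX.ae_tendsto_position_div hp hf hc hk_top hx, fun h => ?_⟩
  have hex : ∃ x, ElephantWalk.IsUniqueFixedPoint (ElephantWalk.drift p f) x := by
    rcases h with ⟨-, h⟩ | ⟨-, h⟩ | ⟨c, hlip, hcp⟩
    · exact ElephantWalk.exists_isUniqueFixedPoint_of_strictAntiOn hp hf hc h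
    · exact ElephantWalk.exists_isUniqueFixedPoint_of_strictConvexOn hp hp' hf hc h
    · exact ElephantWalk.exists_isUniqueFixedPoint_of_lipschitz hp hf hc hlip hcp
  obtain ⟨x, hx⟩ := hex
  exact ⟨x, hx, hX.ae_tendsto_position_div hp hf hc hk_top hx⟩
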